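/- **Logic.** $\mathsf{FO+C}$ over a relational vocabulary $\tau$ has vertex variables (ranging over the universe $A$ of a finite $\tau$-structure), number variables (ranging over $\mathbb N$), relation variables of types $\{\vec t\}$ and function variables of types $\vec t\to \mathtt n$, for $\vec t\in\{\mathtt v,\mathtt n\}^*$ (interpreted by arbitrary subsets of $A^{\vec t}$ and functions $A^{\vec t}\to\mathbb N$, where $\mathtt v$ stands for $A$ and $\mathtt n$ for $\mathbb N$). Terms are built from number variables, $0,1$, $+$, $\cdot$, function variables applied to vertex variables and terms, and counting terms $\#(x_1,\dots,x_k,y_1<\theta_1,\dots,y_\ell<\theta_\ell).\varphi$ with $k+\ell\ge 1$, whose value is the number of tuples satisfying $\varphi$ and the bounds, where $\theta_i$ may depend on $x_1,\dots,x_k,y_1,\dots,y_{i-1}$. Formulas are built from $\theta\le\theta'$, $x=x'$, $R(\vec x)$ with $R\in\tau$, and relation variables applied to vertex variables and terms, by $\neg$ and $\wedge$. A formula or term is *arithmetical* if it contains no vertex variables (and no symbols of $\tau$). **Representation of numbers.** Fix a number variable $\hat y$. For a formula $\chi$, a term $\theta$, a structure $A$ and an assignment $\alpha$ over $A$, let $$\langle\!\langle\chi,\theta\rangle\!\rangle^{(A,\alpha)}=\sum\{2^i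 : i<\theta^{(A,\alpha)},\ (A,\alpha[i/\hat y])\models\chi\}.$$ For $Y$ of type $\{\mathtt n\vec t\}$, $U$ of type $\vec t\to\mathtt n$ and $\vec c\in A^{\vec t}$, let $$\langle\!\langle Y,U\rangle\!\rangle^{(A,\alpha)}(\vec c)=\sum\{2^j : j<\alpha(U)(\vec c),\ (j,\vec c)\in\alpha(Y)\};$$ if $U$ has type $\emptyset\to\mathtt n$, the bound $\alpha(U)(\vec c)$ is replaced by the number $\alpha(U)$. **Theorem.** 1. Let $Y$ be a relation variable of type $\{(\mathtt n,\mathtt n)\}$ and $U$ a function variable of type $\emptyset\to\mathtt n$. There are an arithmetical $\mathsf{FO+C}$-formula $\mathsf{s\text{-}itadd}$ and an arithmetical $\mathsf{FO+C}$-term $\mathsf{bd\text{-}s\text{-}itadd}$ such that for all finite structures $A$ and all assignments $\alpha$ over $A$, $$\langle\!\langle\mathsf{s\text{-}itadd},\mathsf{bd\text{-}s\text{-}itadd}\rangle\!\rangle^{(A,\alpha)}=\sum_{i<\alpha(U)}\langle\!\langle Y,U\rangle\!\rangle^{(A,\alpha)}(i).$$ 2. Let $k,\ell\ge 0$, let $X,Y$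 be relation variables of types $\{\mathtt v^k\mathtt n^\ell\}$ and $\{\mathtt n\mathtt v^k\mathtt n^\ell\}$, and let $U,V$ be function variables of types $\mathtt v^k\mathtt n^\ell\to\mathtt n$ and $\mathtt v^k\to\mathtt n$. There are an $\mathsf{FO+C}$-formula $\mathsf{itadd}$ and an $\mathsf{FO+C}$-term $\mathsf{bd\text{-}itadd}$, both arithmetical if $k=0$, such that for all finite structures $A$ and all assignments $\alpha$ over $A$, $$\langle\!\langle\mathsf{itadd},\mathsf{bd\text{-}itadd}\rangle\!\rangle^{(A,\alpha)}=\sum_{(\vec a,\vec b)}\langle\!\langle Y,U\rangle\!\rangle^{(A,\alpha)}(\vec a,\vec b),$$ where the sum ranges over all $(\vec a,\vec b)\in\alpha(X)$ with $\vec a\in A^k$ and $\vec b=(b_1,\dots,b_\ell)\in\mathbb N^\ell$ such that $b_i<\alpha(V)(\vec a)$ for all $i$. 3. (Iterated addition over ordered structures, the descriptive form of membership in uniform $\mathsf{TC}^0$.) There is an $\mathsf{FO+C}$-formula $\varphi$ of vocabulary $\{E,\leqslant\}$ (two binary symbols), without relation and function variables, such that for every finite structure $A$ of order $n$ in which $\leqslant$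 is a linear order, with elements $\langle 0\rangle<\dots<\langle n-1\rangle$, and for all $p,q<n$ and all assignments with $x_1\mapsto\langle p\rangle$, $x_2\mapsto\langle q\rangle$: $\varphi$ holds if and only if the bit at position $p+nq$ of $$\sum_{i<n}\ \sum_{j<n,\ E(\langle j\rangle,\langle i\rangle)}2^j$$ is $1$. (All bits of this sum are at positions below $n^2$.) -/

import Mathlib

/-! First-order logic with counting (FO+C) with relation and function variables. -/

namespace FOC

/-- The two types of individuals: vertices `v` and numbers `n`. -/
inductive Ty
  | v
  | n

/-- `Tuple A t` is the set `A^t` of all tuples whose `i`-th entry is an element of `A` if the `i`-th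
entry of the type `t` is `v`, and a natural number if it is `n`. -/
def Tuple (A : Type) : List Ty → Type
  | [] => Unit
  | .v :: t => A × Tuple A t
  | .n :: t => ℕ × Tuple A t

/-- The type `v^k n^l`. -/
def vn (k l : ℕ) : List Ty := List.replicate k .v ++ List.replicate l .n

/-- The tuple `(a, b)` of type `v^k n^l`. -/
def mkTuple {A : Type} : (k l : ℕ) → (Fin k → A) → (Fin l → ℕ) → Tuple A (vn k l)
  | 0, 0, _, _ => ()
  | 0, l + 1, a, b => (b 0, mkTuple 0 l a (fun i => b i.succ))
  | k + 1, l, a, b => (a 0, mkTuple k l (fun i => a i.succ) b)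

/-- Vertex variables. -/
abbrev VertexVar : Type := ℕ

/-- Number variables. -/
abbrev NumberVar : Type := ℕ

/-- Relation variables of type `{t}`; there is a countable supply for every `t`. -/
abbrev RelVar (_t : List Ty) : Type := ℕ

/-- Function variables of type `t → n`; there is a countable supply for every `t`. -/
abbrev FunVar (_t : List Ty) : Type := ℕ

/-- The syntactic categories: terms, formulas, and argument lists of type `t`. -/
inductive Kind
  | term
  | formula
  | args (t : List Ty)

/-- FO+C-expressions over the relation symbols of `L`. -/
inductive Expr (L : FirstOrder.Language.{0, 0}) : Kind → Type
  /-- number variables -/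
  | numVar (y : NumberVar) : Expr L .term
  | zero : Expr L .term
  | one : Expr L .term
  | add (s s' : Expr L .term) : Expr L .term
  | mul (s s' : Expr L .term) : Expr L .term
  /-- the term `U(ξ₁, …, ξₖ)` -/
  | funApp (t : List Ty) (U : FunVar t) (ξ : Expr L (.args t)) : Expr L .term
  /-- the counting term `#(x₁, …, xₖ, y₁ < θ₁, …, yₗ < θₗ). φ`, with distinct variables -/
  | count (k l : ℕ) (hkl : 1 ≤ k + l)
      (x : Fin k → VertexVar) (hx : Function.Injective x)
      (y : Fin l → NumberVar) (hy : Function.Injective y)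
      (θ : Fin l → Expr L .term) (φ : Expr L .formula) : Expr L .term
  | le (s s' : Expr L .term) : Expr L .formula
  /-- the formula `x = x'` for vertex variables -/
  | vertexEq (x x' : VertexVar) : Expr L .formula
  /-- the formula `R(x₁, …, xₖ)` for a relation symbol of the vocabulary -/
  | rel {k : ℕ} (R : L.Relations k) (x : Fin k → VertexVar) : Expr L .formula
  | not (φ : Expr L .formula) : Expr L .formula
  | and (φ ψ : Expr L .formula) : Expr L .formula
  /-- the formula `X(ξ₁, …, ξₖ)` for a relation variable -/
  | relApp (t : List Ty) (X : RelVar t) (ξ : Expr L (.args t)) : Expr L .formula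
  /-- argument lists: a vertex variable at each `v`, a term at each `n` -/
  | nil : Expr L (.args [])
  | consV {t : List Ty} (x : VertexVar) (ξ : Expr L (.args t)) : Expr L (.args (.v :: t))
  | consN {t : List Ty} (s : Expr L .term) (ξ : Expr L (.args t)) : Expr L (.args (.n :: t))

/-- FO+C-terms. -/
abbrev Term (L : FirstOrder.Language.{0, 0}) : Type := Expr L .term

/-- FO+C-formulas. -/
abbrev Formula (L : FirstOrder.Language.{0, 0}) : Type := Expr L .formula

/-- Assignments over a structure with universe `A`. -/
structure Assignment (A : Type) where
  vertex : VertexVar → A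
  number : NumberVar → ℕ
  rel : (t : List Ty) → RelVar t → Set (Tuple A t)
  func : (t : List Ty) → FunVar t → Tuple A t → ℕ

/-- The assignment that maps `xᵢ` to `aᵢ` and `yⱼ` to `bⱼ` and agrees with `α` on all other
variables (for families `x`, `y` of distinct variables). -/
noncomputable def Assignment.subst {A : Type} (α : Assignment A) {ι κ : Type}
    (x : ι → VertexVar) (a : ι → A) (y : κ → NumberVar) (b : κ → ℕ) : Assignment A :=
  { α with
    vertex := Function.extend x a α.vertex
    number := Function.extend y b α.number }

/-- What an expression of each kind denotes. -/
abbrev Kind.Val (A : Type) : Kind → Type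
  | .term => ℕ
  | .formula => Prop
  | .args t => Tuple A t

/-- The semantics of FO+C-expressions. In a counting term, the bound `θᵢ` is evaluated under the
values of all `x` and of those `yⱼ` with `j < i` (adaptive bounds). -/
noncomputable def Expr.eval {L : FirstOrder.Language.{0, 0}} {A : Type} [L.Structure A] :
    {κ : Kind} → Expr L κ → Assignment A → κ.Val A
  | _, .numVar y, α => α.number y
  | _, .zero, _ => (0 : ℕ)
  | _, .one, _ => (1 : ℕ)
  | _, .add s s', α => (s.eval α : ℕ) + (s'.eval α : ℕ)
  | _, .mul s s', α => (s.eval α : ℕ) * (s'.eval α : ℕ)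
  | _, .funApp t U ξ, α => α.func t U (ξ.eval α)
  | _, .count k l _ x _ y _ θ φ, α =>
      Set.ncard {c : (Fin k → A) × (Fin l → ℕ) |
        (∀ i : Fin l, c.2 i < ((θ i).eval
          (α.subst x c.1 (fun j : {j : Fin l // j < i} => y j) (fun j => c.2 j)) : ℕ)) ∧
        φ.eval (α.subst x c.1 y c.2)}
  | _, .le s s', α => (s.eval α : ℕ) ≤ (s'.eval α : ℕ)
  | _, .vertexEq x x', α => α.vertex x = α.vertex x'
  | _, .rel R x, α => FirstOrder.Language.Structure.RelMap R (fun i => α.vertex (x i))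
  | _, .not φ, α => ¬ φ.eval α
  | _, .and φ ψ, α => φ.eval α ∧ ψ.eval α
  | _, .relApp t X ξ, α => ξ.eval α ∈ α.rel t X
  | _, .nil, _ => ()
  | _, .consV x ξ, α => (α.vertex x, ξ.eval α)
  | _, .consN s ξ, α => (s.eval α, ξ.eval α)

/-- The value of a term. -/
noncomputable def Term.value {L : FirstOrder.Language.{0, 0}} {A : Type} [L.Structure A]
    (s : Term L) (α : Assignment A) : ℕ := Expr.eval s α

/-- `(A, α) ⊨ φ`. -/
def Formula.Holds {L : FirstOrder.Language.{0, 0}} {A : Type} [L.Structure A]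
    (φ : Formula L) (α : Assignment A) : Prop := Expr.eval φ α

/-- An expression is arithmetical if it contains no vertex variables. (Relation symbols of the
vocabulary are excluded altogether, including those of arity `0`, so that the value of an
arithmetical expression does not depend on the structure.) -/
def Expr.IsArithmetical {L : FirstOrder.Language.{0, 0}} : {κ : Kind} → Expr L κ → Prop
  | _, .numVar _ => True
  | _, .zero => True
  | _, .one => True
  | _, .add s s' => s.IsArithmetical ∧ s'.IsArithmetical
  | _, .mul s s' => s.IsArithmetical ∧ s'.IsArithmetical
  | _, .funApp _ _ ξ => ξ.IsArithmetical
  | _, .count k _ _ _ _ _ _ θ φ => k = 0 ∧ (∀ i, (θ i).IsArithmetical) ∧ φ.IsArithmetical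
  | _, .le s s' => s.IsArithmetical ∧ s'.IsArithmetical
  | _, .vertexEq _ _ => False
  | _, .rel _ _ => False
  | _, .not φ => φ.IsArithmetical
  | _, .and φ ψ => φ.IsArithmetical ∧ ψ.IsArithmetical
  | _, .relApp _ _ ξ => ξ.IsArithmetical
  | _, .nil => True
  | _, .consV _ _ => False
  | _, .consN s ξ => s.IsArithmetical ∧ ξ.IsArithmetical

/-- An expression is plain if it contains no relation or function variables. -/
def Expr.IsPlain {L : FirstOrder.Language.{0, 0}} : {κ : Kind} → Expr L κ → Prop
  | _, .numVar _ => True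
  | _, .zero => True
  | _, .one => True
  | _, .add s s' => s.IsPlain ∧ s'.IsPlain
  | _, .mul s s' => s.IsPlain ∧ s'.IsPlain
  | _, .funApp _ _ _ => False
  | _, .count _ _ _ _ _ _ _ θ φ => (∀ i, (θ i).IsPlain) ∧ φ.IsPlain
  | _, .le s s' => s.IsPlain ∧ s'.IsPlain
  | _, .vertexEq _ _ => True
  | _, .rel _ _ => True
  | _, .not φ => φ.IsPlain
  | _, .and φ ψ => φ.IsPlain ∧ ψ.IsPlain
  | _, .relApp _ _ _ => False
  | _, .nil => True
  | _, .consV _ ξ => ξ.IsPlain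
  | _, .consN s ξ => s.IsPlain ∧ ξ.IsPlain

open scoped Classical in
/-- The number `∑ 2^i` over all `i < m` in `S`. -/
noncomputable def bitsToNat (S : Set ℕ) (m : ℕ) : ℕ :=
  ∑ i ∈ Finset.range m with i ∈ S, 2 ^ i

/-- The distinguished number variable `ŷ`. -/
def yHat : NumberVar := 0

/-- The assignment `α[i/ŷ]`. -/
def Assignment.setHat {A : Type} (α : Assignment A) (i : ℕ) : Assignment A :=
  { α with number := Function.update α.number yHat i }

/-- The number `⟪χ, θ⟫` specified by a formula `χ` (with `ŷ` free) and a term `θ`. -/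
noncomputable def exprNum {L : FirstOrder.Language.{0, 0}} {A : Type} [L.Structure A]
    (χ : Formula L) (θ : Term L) (α : Assignment A) : ℕ :=
  bitsToNat {i | χ.Holds (α.setHat i)} (θ.value α)

/-- The number `⟪Y, U⟫(c)` for `Y` of type `{n t}` and `U` of type `t → n`. -/
noncomputable def varNum {A : Type} (t : List Ty) (Y : RelVar (.n :: t)) (U : FunVar t)
    (α : Assignment A) (c : Tuple A t) : ℕ :=
  bitsToNat {j | ((j, c) : ℕ × Tuple A t) ∈ α.rel (.n :: t) Y} (α.func t U c)

/-- The number `⟪Y, U⟫(i)` for `Y` of type `{(n, n)}` and `U` of type `∅ → n`. -/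
noncomputable def varNumUniform {A : Type} (Y : RelVar [.n, .n]) (U : FunVar [])
    (α : Assignment A) (i : ℕ) : ℕ :=
  bitsToNat {j | ((j, i, ()) : ℕ × ℕ × Unit) ∈ α.rel [.n, .n] Y} (α.func [] U ())

/-- A binary relation symbol `bit` together with the order symbol `le`. -/
inductive BitOrderRel : ℕ → Type
  | bit : BitOrderRel 2
  | le : BitOrderRel 2

/-- The vocabulary of ordered structures with one binary relation. -/
def bitOrder : FirstOrder.Language.{0, 0} := ⟨fun _ => Empty, BitOrderRel⟩

/-- The relation `bit` of a structure. -/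
def Bit {A : Type} [bitOrder.Structure A] (b a : A) : Prop :=
  FirstOrder.Language.Structure.RelMap (L := bitOrder) BitOrderRel.bit ![b, a]

/-- The relation `le` of a structure. -/
def Le {A : Type} [bitOrder.Structure A] (b a : A) : Prop :=
  FirstOrder.Language.Structure.RelMap (L := bitOrder) BitOrderRel.le ![b, a]

/-- The position of an element in a finite linear order, starting from `0`. -/
noncomputable def pos {A : Type} [LinearOrder A] (a : A) : ℕ := {b : A | b < a}.ncard

open scoped Classical in
/-- An ordered structure of order `n` encodes `n` numbers of `n` bits each: the bit at position
`pos b` of the number with index `a` is one iff `Bit b a`. This is the sum of these numbers. -/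
noncomputable def structSum (A : Type) [Fintype A] [LinearOrder A] [bitOrder.Structure A] : ℕ :=
  ∑ a : A, ∑ b : A with Bit b a, 2 ^ pos b

end FOC

/-!
In all three parts the sum is sorted by bit positions: it equals `∑ 2 ^ j * s j`, where the column
count `s j` is the number of summands with a `1` at position `j` (`sum_bitsToNat`, `structSum_eq`).
A column count is the value of a counting term, and all of them are bounded by the value `m` of
another term, so it remains to define the bits of such a weighted sum (`holds_bitF`).

Let `C i = (∑ j < i, 2 ^ j * s j) / 2 ^ i` be the carry into position `i`. The bit at position `i` is
the parity of `C i + s i` (`testBit_sum_two_pow`), and `C (i + 1) = (C i + s i) / 2` (`carry_succ`).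
If `2 ^ w` is the least power of two above `m`, then all but the `w` positions just below `i`
contribute less than `2 ^ i` in total. So the carry `L i` that comes from these `w` positions alone
satisfies `L i ≤ C i ≤ L i + 1` (`approxCarry_spec`), and `L i` is the quotient of two numbers that
are polynomial in `m`, hence denoted by terms; powers of two are recognized by their divisors, and
their exponents are found by counting smaller powers.

The excess `C i - L i` is `0` or `1`, and its value at `i + 1` is a monotone function of its value
at `i`. As in the addition of two numbers, it is `1` iff it is generated at some earlier position and
propagated at all positions after that (`approxCarry_lt_iff`), which is a first-order condition.

Expressions are evaluated under assignments `α.withNumber ρ`, where `α` is fixed and only the number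
assignment `ρ` varies. The number variables used by `bitF` are fixed: `0` is `ŷ`, `1` is the
argument of the column count, `2, …, 5` are bound inside terms, and `6, 7` are bound by the
quantifiers of the carry look-ahead and the parity test.
-/

namespace FOC

/-! ### Carry look-ahead for sums of weighted powers of two -/

/-- The number of powers of two below `n`; this is the exponent when `n` is a power of two. -/
noncomputable def powCount (n : ℕ) : ℕ := by
  classical exact ((Finset.range n).filter fun z => ∃ k, z = 2 ^ k).card

theorem powCount_two_pow (k : ℕ) : powCount (2 ^ k) = k := by
  classical
  have : ((Finset.range (2 ^ k)).filter fun z => ∃ k, z = 2 ^ k)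
      = (Finset.range k).image (fun i => 2 ^ i) := by
    ext z
    simp only [Finset.mem_filter, Finset.mem_range, Finset.mem_image]
    constructor
    · rintro ⟨h, i, rfl⟩
      exact ⟨i, (Nat.pow_lt_pow_iff_right (by norm_num)).1 h, rfl⟩
    · rintro ⟨i, h, rfl⟩
      exact ⟨(Nat.pow_lt_pow_iff_right (by norm_num)).2 h, i, rfl⟩
  unfold powCount
  convert congrArg Finset.card this using 1
  rw [Finset.card_image_of_injective _ (Nat.pow_right_injective le_rfl), Finset.card_range]

/-- A number is a power of two iff it is positive and has no odd divisor greater than `1`. -/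
theorem exists_eq_two_pow_iff (y : ℕ) :
    (∃ k, y = 2 ^ k) ↔ 1 ≤ y ∧ ¬ ∃ d < y, ∃ e < y + 1, (d + d + 1 + 1 + 1) * e = y := by
  constructor
  · rintro ⟨k, rfl⟩
    refine ⟨Nat.one_le_two_pow, ?_⟩
    rintro ⟨d, -, e, -, h⟩
    obtain ⟨i, -, hi⟩ := (Nat.dvd_prime_pow Nat.prime_two).1 (Dvd.intro e h)
    cases i with
    | zero => simp at hi
    | succ i => rw [pow_succ] at hi; omega
  · rintro ⟨h1, h2⟩
    obtain ⟨k, n, ⟨d, rfl⟩, h⟩ := Nat.exists_eq_two_pow_mul_odd (n := y) (by omega)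
    cases d with
    | zero => exact ⟨k, by simpa using h⟩
    | succ d =>
      have hk : 1 ≤ 2 ^ k := Nat.one_le_two_pow
      refine absurd ⟨d, ?_, 2 ^ k, ?_, ?_⟩ h2
      · rw [h]; nlinarith
      · rw [h]; nlinarith
      · rw [h]; ring

/-- The least `w` with `m < 2 ^ w`; the powers of two up to `m` are those with exponents below `w`. -/
theorem exists_two_pow_window (m : ℕ) : ∃ w, m < 2 ^ w ∧ ∀ k, 2 ^ k ≤ m ↔ k < w := by
  refine ⟨Nat.size m, Nat.lt_size_self m, fun k => Nat.lt_size.symm⟩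

open scoped Classical in
theorem sum_pow_le_eq {m w : ℕ} (hw : ∀ k, 2 ^ k ≤ m ↔ k < w) (f : ℕ → ℕ) :
    (∑ z ∈ Finset.range (m + 1), if ∃ k, z = 2 ^ k then f z else 0)
      = ∑ k ∈ Finset.range w, f (2 ^ k) := by
  rw [← Finset.sum_filter]
  symm
  refine Finset.sum_bij (fun k _ => 2 ^ k) ?_ ?_ ?_ ?_
  · intro k hk
    simp only [Finset.mem_filter, Finset.mem_range] at *
    exact ⟨Nat.lt_succ_of_le ((hw k).2 hk), k, rfl⟩
  · intro a _ b _ h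
    exact Nat.pow_right_injective le_rfl h
  · intro z hz
    simp only [Finset.mem_filter, Finset.mem_range] at hz
    obtain ⟨hz, k, rfl⟩ := hz
    exact ⟨k, Finset.mem_range.2 ((hw k).1 (Nat.lt_succ_iff.1 hz)), rfl⟩
  · intros; rfl

/-- The sum of `2 ^ (j + w - i) * s j` over the `w` positions `j` below `i`, which approximates
`2 ^ w` times the carry into position `i`. -/
def windowSum (s : ℕ → ℕ) (w i : ℕ) : ℕ :=
  ∑ j ∈ Finset.range i, ∑ k ∈ Finset.range w, if j + w = i + k then 2 ^ k * s j else 0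

/-- The approximate carry into position `i`, from the `w` positions below it. -/
def approxCarry (s : ℕ → ℕ) (w i : ℕ) : ℕ := windowSum s w i / 2 ^ w

theorem sum_two_pow_le {s : ℕ → ℕ} {m : ℕ} (hs : ∀ j, s j ≤ m) (n : ℕ) :
    ∑ j ∈ Finset.range n, 2 ^ j * s j + m ≤ m * 2 ^ n := by
  induction n with
  | zero => simp
  | succ n ih =>
    rw [Finset.sum_range_succ, pow_succ]
    have := Nat.mul_le_mul_left (2 ^ n) (hs n)
    nlinarith

/-- The window below `i` and the positions below the window make up all positions below `i`. -/
theorem windowSum_add {s : ℕ → ℕ} (w i : ℕ) :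
    2 ^ i * windowSum s w i + 2 ^ w * ∑ j ∈ Finset.range (i - w), 2 ^ j * s j
      = 2 ^ w * ∑ j ∈ Finset.range i, 2 ^ j * s j := by
  have h1 : ∀ j ∈ Finset.range i,
      2 ^ i * (∑ k ∈ Finset.range w, if j + w = i + k then 2 ^ k * s j else 0)
        = if j < i - w then 0 else 2 ^ w * (2 ^ j * s j) := by
    intro j hj
    rw [Finset.mem_range] at hj
    split_ifs with h
    · rw [Finset.sum_eq_zero, mul_zero]
      intro k _
      rw [if_neg (by omega)]
    · rw [Finset.sum_eq_single (j + w - i)]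
      · rw [if_pos (by omega), ← mul_assoc, ← mul_assoc, ← pow_add, ← pow_add]
        congr 2; omega
      · intro k _ hk
        rw [if_neg (by omega)]
      · intro hk
        rw [Finset.mem_range] at hk; omega
  have h2 : Finset.range (i - w) = (Finset.range i).filter (· < i - w) := by
    ext j; simp only [Finset.mem_range, Finset.mem_filter]; omega
  rw [windowSum, Finset.mul_sum, Finset.sum_congr rfl h1, h2, Finset.mul_sum, Finset.sum_filter,
    ← Finset.sum_add_distrib, Finset.mul_sum]
  refine Finset.sum_congr rfl fun j _ => ?_
  split_ifs <;> simp

/-- The carry into position `i` exceeds its approximation by at most one: the positions more than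
`w` below `i` contribute less than `2 ^ i`. -/
theorem approxCarry_spec {s : ℕ → ℕ} {m w : ℕ} (hs : ∀ j, s j ≤ m) (hw : m < 2 ^ w) (i : ℕ) :
    approxCarry s w i ≤ (∑ j ∈ Finset.range i, 2 ^ j * s j) / 2 ^ i ∧
      (∑ j ∈ Finset.range i, 2 ^ j * s j) / 2 ^ i ≤ approxCarry s w i + 1 := by
  have hadd := windowSum_add (s := s) w i
  set Z := ∑ j ∈ Finset.range i, 2 ^ j * s j
  set Z' := ∑ j ∈ Finset.range (i - w), 2 ^ j * s j with hZ'
  have hlow : 2 ^ w * Z' < 2 ^ w * 2 ^ i := by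
    refine Nat.mul_lt_mul_of_pos_left ?_ (by positivity)
    rcases le_total i w with h | h
    · rw [hZ', Nat.sub_eq_zero_of_le h]; simp
    · have h1 := sum_two_pow_le hs (i - w)
      have h2 : 2 ^ w * 2 ^ (i - w) = 2 ^ i := by rw [← pow_add]; congr 1; omega
      have h3 : m * 2 ^ (i - w) < 2 ^ w * 2 ^ (i - w) :=
        Nat.mul_lt_mul_of_pos_right hw (by positivity)
      omega
  have hT := Nat.div_add_mod (windowSum s w i) (2 ^ w)
  have hT' := Nat.mod_lt (windowSum s w i) (y := 2 ^ w) (by positivity)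
  change 2 ^ w * approxCarry s w i + _ = _ at hT
  generalize approxCarry s w i = L at *
  generalize windowSum s w i % 2 ^ w = R at *
  generalize windowSum s w i = T at *
  have hw0 : 0 < 2 ^ w := by positivity
  have hi0 : 0 < 2 ^ i := by positivity
  constructor
  · rw [Nat.le_div_iff_mul_le hi0]
    refine Nat.le_of_mul_le_mul_left ?_ hw0
    nlinarith
  · rw [← Nat.lt_succ_iff, Nat.div_lt_iff_lt_mul hi0]
    refine Nat.lt_of_mul_lt_mul_left (a := 2 ^ w) ?_
    have : 2 ^ i * T + 2 ^ i ≤ 2 ^ i * (2 ^ w * (L + 1)) := by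
      rw [← Nat.mul_succ]; exact Nat.mul_le_mul_left _ (by rw [Nat.mul_succ]; omega)
    rw [Nat.succ_eq_add_one]
    nlinarith

theorem carry_succ (s : ℕ → ℕ) (i : ℕ) :
    (∑ j ∈ Finset.range (i + 1), 2 ^ j * s j) / 2 ^ (i + 1)
      = ((∑ j ∈ Finset.range i, 2 ^ j * s j) / 2 ^ i + s i) / 2 := by
  rw [Finset.sum_range_succ, pow_succ, ← Nat.div_div_eq_div_mul,
    Nat.add_mul_div_left _ _ (by positivity)]

/-- Carry look-ahead: the true carry exceeds the approximate one iff an excess is generated at some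
position and propagated from there on. -/
theorem approxCarry_lt_iff {s : ℕ → ℕ} {m w : ℕ} (hs : ∀ j, s j ≤ m) (hw : m < 2 ^ w) (i : ℕ) :
    approxCarry s w i < (∑ j ∈ Finset.range i, 2 ^ j * s j) / 2 ^ i ↔
      ∃ k < i, approxCarry s w (k + 1) + approxCarry s w (k + 1) + 1 + 1
          ≤ approxCarry s w k + s k ∧
        ¬ ∃ j < i, k + 1 ≤ j ∧ ¬ approxCarry s w (j + 1) + approxCarry s w (j + 1) + 1
          ≤ approxCarry s w j + s j := by
  induction i with
  | zero => simp
  | succ i ih =>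
    have h0 := approxCarry_spec hs hw i
    have h1 := approxCarry_spec hs hw (i + 1)
    rw [carry_succ] at h1 ⊢
    generalize (∑ j ∈ Finset.range i, 2 ^ j * s j) / 2 ^ i = C at *
    constructor
    · intro h
      by_cases hg : approxCarry s w (i + 1) + approxCarry s w (i + 1) + 1 + 1
          ≤ approxCarry s w i + s i
      · exact ⟨i, by omega, hg, fun ⟨j, hj, hj', _⟩ => by omega⟩
      · obtain ⟨k, hk, hk1, hk2⟩ := ih.1 (by omega)
        refine ⟨k, by omega, hk1, ?_⟩
        rintro ⟨j, hj, hj1, hj2⟩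
        rcases Nat.lt_succ_iff_lt_or_eq.1 hj with hj | rfl
        · exact hk2 ⟨j, hj, hj1, hj2⟩
        · omega
    · rintro ⟨k, hk, hk1, hk2⟩
      rcases Nat.lt_succ_iff_lt_or_eq.1 hk with hk | rfl
      · have hC := ih.2 ⟨k, hk, hk1, fun ⟨j, hj, h⟩ => hk2 ⟨j, by omega, h⟩⟩
        have : approxCarry s w (i + 1) + approxCarry s w (i + 1) + 1
            ≤ approxCarry s w i + s i := by
          by_contra hn
          exact hk2 ⟨i, by omega, by omega, hn⟩
        omega
      · omega

/-- The `i`-th bit of `∑ 2 ^ j * s j` is the parity of `s i` plus the carry into position `i`. -/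
theorem testBit_sum_two_pow {s : ℕ → ℕ} {N : ℕ} (hN : ∀ j, N ≤ j → s j = 0) (i : ℕ) :
    (∑ j ∈ Finset.range N, 2 ^ j * s j).testBit i = true ↔
      ((∑ j ∈ Finset.range i, 2 ^ j * s j) / 2 ^ i + s i) % 2 = 1 := by
  have h : ∀ d, ∑ j ∈ Finset.range (N + d), 2 ^ j * s j = ∑ j ∈ Finset.range N, 2 ^ j * s j := by
    intro d
    rw [Finset.sum_range_add, Finset.sum_eq_zero (s := Finset.range d), add_zero]
    intro x _
    rw [hN _ (by omega), mul_zero]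
  have h' : ∑ j ∈ Finset.range (i + 1 + N), 2 ^ j * s j
      = (∑ j ∈ Finset.range i, 2 ^ j * s j)
        + 2 ^ i * (s i + 2 * ∑ x ∈ Finset.range N, 2 ^ x * s (i + 1 + x)) := by
    rw [Finset.sum_range_add, Finset.sum_range_succ, mul_add, ← add_assoc, ← mul_assoc,
      Finset.mul_sum]
    congr 1
    refine Finset.sum_congr rfl fun x _ => ?_
    ring
  rw [Nat.testBit_eq_decide_div_mod_eq, decide_eq_true_eq, ← h (i + 1), add_comm N, h',
    Nat.add_mul_div_left _ _ (by positivity)]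
  omega

theorem bitsToNat_testBit {Z n : ℕ} (hZ : Z < 2 ^ n) :
    bitsToNat {i | Z.testBit i = true} n = Z := by
  have : ∀ n, bitsToNat {i | Z.testBit i = true} n = Z % 2 ^ n := by
    intro n
    induction n with
    | zero => simp [bitsToNat, Nat.mod_one]
    | succ n ih =>
      rw [pow_succ, Nat.mod_mul, ← ih]
      unfold bitsToNat
      rw [Finset.sum_filter, Finset.sum_filter, Finset.sum_range_succ]
      congr 1
      rcases Nat.mod_two_eq_zero_or_one (Z / 2 ^ n) with h | h <;>
        simp [Nat.testBit_eq_decide_div_mod_eq, h]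
  rw [this, Nat.mod_eq_of_lt hZ]

theorem sum_two_pow_lt {s : ℕ → ℕ} {m : ℕ} (hs : ∀ j, s j ≤ m) :
    ∑ j ∈ Finset.range m, 2 ^ j * s j < 2 ^ (m + m) := by
  have h1 := sum_two_pow_le hs m
  have h2 : m * 2 ^ m < 2 ^ m * 2 ^ m :=
    Nat.mul_lt_mul_of_pos_right Nat.lt_two_pow_self (by positivity)
  rw [pow_add]; omega

/-! ### Evaluation under changed number assignments -/

/-- The assignment `α` with its number assignment replaced by `ρ`. -/
def Assignment.withNumber {A : Type} (α : Assignment A) (ρ : NumberVar → ℕ) : Assignment A :=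
  { α with number := ρ }

variable {L : FirstOrder.Language.{0, 0}}

section

variable {A : Type} [L.Structure A]

/-- Counting with one more variable, whose bound `f d` depends on the other ones, sums the values of
`f`. In this way counting terms with adaptive bounds express sums. -/
theorem ncard_setOf_last_lt {k l : ℕ} (D : Finset ((Fin k → A) × (Fin l → ℕ)))
    (f : (Fin k → A) × (Fin l → ℕ) → ℕ) :
    Set.ncard {c : (Fin k → A) × (Fin (l + 1) → ℕ) |
      (c.1, Fin.init c.2) ∈ D ∧ c.2 (Fin.last l) < f (c.1, Fin.init c.2)} = ∑ d ∈ D, f d := by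
  let g : (Σ _ : (Fin k → A) × (Fin l → ℕ), ℕ) → (Fin k → A) × (Fin (l + 1) → ℕ) :=
    fun p => (p.1.1, Fin.snoc (α := fun _ => ℕ) p.1.2 p.2)
  have hg : Function.Injective g := by
    rintro ⟨⟨a, b⟩, n⟩ ⟨⟨a', b'⟩, n'⟩ h
    obtain ⟨h1, h2⟩ := Prod.ext_iff.1 h
    obtain ⟨h3, h4⟩ := Fin.snoc_injective2 (α := fun _ : Fin (l + 1) => ℕ) h2
    obtain rfl : a = a' := h1
    obtain rfl : b = b' := h3
    obtain rfl : n = n' := h4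
    rfl
  have : {c : (Fin k → A) × (Fin (l + 1) → ℕ) |
      (c.1, Fin.init c.2) ∈ D ∧ c.2 (Fin.last l) < f (c.1, Fin.init c.2)}
      = g '' (D.sigma fun d => Finset.range (f d) : Finset _) := by
    ext ⟨a, c⟩
    simp only [Set.mem_ofPred_eq, Set.mem_image, Finset.mem_coe, Finset.mem_sigma, Finset.mem_range]
    constructor
    · rintro ⟨h1, h2⟩
      exact ⟨⟨(a, Fin.init c), c (Fin.last l)⟩, ⟨h1, h2⟩, by simp [g]⟩
    · rintro ⟨⟨⟨a', b⟩, n⟩, ⟨h1, h2⟩, h⟩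
      obtain ⟨rfl, rfl⟩ := Prod.ext_iff.1 h
      simpa [g] using ⟨h1, h2⟩
  rw [this, Set.ncard_image_of_injective _ hg, Set.ncard_coe_finset, Finset.card_sigma]
  simp

theorem setHat_eq_withNumber (α : Assignment A) (i : ℕ) :
    α.setHat i = α.withNumber (Function.update α.number 0 i) := rfl

theorem extend_of_unique {ι : Type} [Unique ι] (y : ι → NumberVar) (b : ι → ℕ)
    (ρ : NumberVar → ℕ) :
    Function.extend y b ρ = Function.update ρ (y default) (b default) := by
  funext v
  by_cases h : v = y default
  · subst h
    rw [(Function.injective_of_subsingleton y).extend_apply, Function.update_self]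
  · rw [Function.update_of_ne h, Function.extend_apply']
    rintro ⟨i, rfl⟩
    exact h (congrArg y (Subsingleton.elim _ _))

theorem extend_of_isEmpty {ι β : Type} [IsEmpty ι] (y : ι → NumberVar) (b : ι → β)
    (ρ : NumberVar → β) : Function.extend y b ρ = ρ := by
  funext v
  rw [Function.extend_apply']
  rintro ⟨i, -⟩
  exact isEmptyElim i

theorem subst_eq_withNumber (α : Assignment A) {ι κ : Type} [IsEmpty ι]
    (x : ι → VertexVar) (a : ι → A) (y : κ → NumberVar) (b : κ → ℕ) :
    α.subst x a y b = α.withNumber (Function.extend y b α.number) := by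
  unfold Assignment.subst Assignment.withNumber
  rw [extend_of_isEmpty]

@[simp] theorem value_numVar (α : Assignment A) (ρ : NumberVar → ℕ) (y : NumberVar) :
    Term.value (.numVar y : Term L) (α.withNumber ρ) = ρ y := rfl
@[simp] theorem value_one (α : Assignment A) : Term.value (.one : Term L) α = 1 := rfl
@[simp] theorem value_add (α : Assignment A) (s t : Term L) :
    Term.value (.add s t) α = s.value α + t.value α := rfl
@[simp] theorem value_mul (α : Assignment A) (s t : Term L) :
    Term.value (.mul s t) α = s.value α * t.value α := rfl
@[simp] theorem holds_le (α : Assignment A) (s t : Term L) :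
    Formula.Holds (.le s t) α ↔ s.value α ≤ t.value α := Iff.rfl
@[simp] theorem holds_vertexEq (α : Assignment A) (x x' : VertexVar) :
    Formula.Holds (.vertexEq x x' : Formula L) α ↔ α.vertex x = α.vertex x' := Iff.rfl
@[simp] theorem holds_not (α : Assignment A) (φ : Formula L) :
    Formula.Holds (.not φ) α ↔ ¬ φ.Holds α := Iff.rfl
@[simp] theorem holds_and (α : Assignment A) (φ ψ : Formula L) :
    Formula.Holds (.and φ ψ) α ↔ φ.Holds α ∧ ψ.Holds α := Iff.rfl

end

/-! ### Derived terms and formulas -/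

/-- Equality of two terms. -/
def eqF (s t : Term L) : Formula L := .and (.le s t) (.le t s)

/-- The counting term `#(y < θ). φ`. -/
def countT (y : NumberVar) (θ : Term L) (φ : Formula L) : Term L :=
  .count 0 1 le_rfl Fin.elim0 (fun i => i.elim0) (fun _ => y) (fun _ _ _ => Subsingleton.elim _ _)
    (fun _ => θ) φ

/-- Bounded existential quantification over the number variable `y`. -/
def exF (y : NumberVar) (θ : Term L) (φ : Formula L) : Formula L := .le .one (countT y θ φ)

/-- The term with value `1` if `φ` holds, and `0` otherwise. The number variable `5` is reserved as
its dummy variable, so it must not be free in `φ`. -/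
def indT (φ : Formula L) : Term L := countT 5 .one φ

/-- The term `∑_{y < θ} F`, obtained by counting the pairs `(y, y')` with `y < θ` and `y' < F`. The
second variable `y'` is `y + 1`, which may be free in `F`: the bound `F` lies outside its scope. -/
def sumT (y : NumberVar) (θ F : Term L) : Term L :=
  .count 0 2 (by norm_num) Fin.elim0 (fun i => i.elim0) (fun i => y + i)
    (fun i j h => by simpa [Fin.ext_iff] using h) ![θ, F] (.le .zero .zero)

section

variable {A : Type} [L.Structure A] (α : Assignment A) (ρ : NumberVar → ℕ)

@[simp] theorem holds_eqF (s t : Term L) : (eqF s t).Holds α ↔ s.value α = t.value α := by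
  rw [eqF, holds_and, holds_le, holds_le, le_antisymm_iff]

open scoped Classical in
@[simp] theorem value_countT (y : NumberVar) (θ : Term L) (φ : Formula L) :
    (countT y θ φ).value (α.withNumber ρ) = ((Finset.range (θ.value (α.withNumber ρ))).filter
      fun n => φ.Holds (α.withNumber (Function.update ρ y n))).card := by
  change Set.ncard {c : (Fin 0 → A) × (Fin 1 → ℕ) | _ ∧ _} = _
  rw [← Set.ncard_coe_finset, ← Set.ncard_image_of_injective _
    (f := fun n : ℕ => ((Fin.elim0, fun _ => n) : (Fin 0 → A) × (Fin 1 → ℕ)))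
    (fun m n h => congrFun (congrArg Prod.snd h) 0)]
  congr 1
  ext ⟨a, b⟩
  obtain rfl : a = Fin.elim0 := Subsingleton.elim _ _
  obtain ⟨n, rfl⟩ : ∃ n, b = fun _ => n := ⟨b 0, by funext i; rw [Subsingleton.elim i 0]⟩
  have h1 : (α.withNumber ρ).subst (Fin.elim0 : Fin 0 → VertexVar) (Fin.elim0 : Fin 0 → A)
      (fun _ : Fin 1 => y) (fun _ => n) = α.withNumber (Function.update ρ y n) := by
    rw [subst_eq_withNumber, extend_of_unique]
    rfl
  have h2 : ∀ i : Fin 1, (α.withNumber ρ).subst (Fin.elim0 : Fin 0 → VertexVar)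
      (Fin.elim0 : Fin 0 → A) (fun _ : {j : Fin 1 // j < i} => y) (fun _ => n)
      = α.withNumber ρ := by
    intro i
    have : IsEmpty {j : Fin 1 // j < i} := ⟨fun ⟨j, hj⟩ => by omega⟩
    rw [subst_eq_withNumber, extend_of_isEmpty]
    rfl
  simp only [Set.mem_ofPred_eq, h1, h2]
  simp only [Set.mem_image, Prod.mk.injEq, true_and, funext_iff, Finset.mem_coe, forall_const,
    exists_eq_right, Finset.mem_filter, Finset.mem_range]
  exact Iff.rfl

@[simp] theorem value_sumT (y : NumberVar) (θ F : Term L) :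
    (sumT y θ F).value (α.withNumber ρ) = ∑ n ∈ Finset.range (θ.value (α.withNumber ρ)),
      F.value (α.withNumber (Function.update ρ y n)) := by
  have key := ncard_setOf_last_lt (A := A) (k := 0) (l := 1)
    ((Finset.range (θ.value (α.withNumber ρ))).map
      ⟨fun n => (Fin.elim0, fun _ => n), fun m n h => congrFun (congrArg Prod.snd h) 0⟩)
    (fun d => F.value (α.withNumber (Function.update ρ y (d.2 0))))
  rw [Finset.sum_map] at key
  refine Eq.trans ?_ key
  change Set.ncard {c : (Fin 0 → A) × (Fin 2 → ℕ) | _ ∧ _} = _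
  congr 1
  ext ⟨a, b⟩
  obtain rfl : a = Fin.elim0 := Subsingleton.elim _ _
  have h1 : (α.withNumber ρ).subst (Fin.elim0 : Fin 0 → VertexVar) (Fin.elim0 : Fin 0 → A)
      (fun j : {j : Fin 2 // j < 0} => y + (j : Fin 2)) (fun j => b j) = α.withNumber ρ := by
    have : IsEmpty {j : Fin 2 // j < 0} := ⟨fun ⟨j, hj⟩ => by omega⟩
    rw [subst_eq_withNumber, extend_of_isEmpty]
    rfl
  have h2 : (α.withNumber ρ).subst (Fin.elim0 : Fin 0 → VertexVar) (Fin.elim0 : Fin 0 → A)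
      (fun j : {j : Fin 2 // j < 1} => y + (j : Fin 2)) (fun j => b j)
      = α.withNumber (Function.update ρ y (b 0)) := by
    let _ : Unique {j : Fin 2 // j < 1} :=
      ⟨⟨⟨0, by omega⟩⟩, fun ⟨j, hj⟩ => Subtype.ext (by change j = 0; omega)⟩
    rw [subst_eq_withNumber, extend_of_unique]
    rfl
  have h3 : (b : Fin 2 → ℕ) (Fin.last 1) = b 1 := rfl
  have h4 : Fin.init (α := fun _ : Fin 2 => ℕ) b = fun _ => b 0 := by
    funext i; rw [Subsingleton.elim i 0]; rfl
  simp only [Set.mem_ofPred_eq, Fin.forall_fin_two, Matrix.cons_val_zero, Matrix.cons_val_one, h1,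
    h2, h3, h4]
  simp only [Finset.mem_map, Finset.mem_range]
  constructor
  · rintro ⟨⟨h0, h1⟩, -⟩
    exact ⟨⟨_, h0, rfl⟩, h1⟩
  · rintro ⟨⟨n, hn, h⟩, h1⟩
    obtain rfl : n = b 0 := congrFun (congrArg Prod.snd h) 0
    exact ⟨⟨hn, h1⟩, le_rfl (a := 0)⟩

@[simp] theorem holds_exF (y : NumberVar) (θ : Term L) (φ : Formula L) :
    (exF y θ φ).Holds (α.withNumber ρ) ↔ ∃ n < θ.value (α.withNumber ρ),
      φ.Holds (α.withNumber (Function.update ρ y n)) := by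
  rw [exF, holds_le, value_one, value_countT, Nat.one_le_iff_ne_zero, ← Nat.pos_iff_ne_zero,
    Finset.card_pos]
  simp [Finset.Nonempty]

open scoped Classical in
@[simp] theorem value_indT (φ : Formula L) :
    (indT φ).value (α.withNumber ρ)
      = if φ.Holds (α.withNumber (Function.update ρ 5 0)) then 1 else 0 := by
  rw [indT, value_countT, value_one, Finset.range_one, Finset.filter_singleton]
  split_ifs <;> rfl

end

/-! ### The bits of a sum of weighted powers of two -/

/-- The number variable `2` denotes a power of two: it is positive and not divisible by any
`2 * d + 3`. -/
def pow2F : Formula L :=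
  .and (.le .one (.numVar 2)) (.not (exF 3 (.numVar 2) (exF 4 (.add (.numVar 2) .one)
    (eqF (.mul (.add (.add (.add (.add (.numVar 3) (.numVar 3)) .one) .one) .one) (.numVar 4))
      (.numVar 2)))))

/-- The number of powers of two below `t`. -/
def powCountT (t : Term L) : Term L := countT 2 t pow2F

/-- The least power of two greater than `M`, as `1` plus the sum of all smaller ones. -/
def nextPowT (M : Term L) : Term L :=
  .add .one (sumT 2 (.add M .one) (.mul (indT pow2F) (.numVar 2)))

/-- The term for `windowSum` at position `t`, where `S` denotes an entry as a function of the number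
variable `1`, and `M` bounds the entries. The exponents `k < w` are represented by the powers
`2 ^ k ≤ M`. -/
def windowT (S M t : Term L) : Term L :=
  sumT 1 t (sumT 2 (.add M .one) (.mul
    (indT (.and pow2F (eqF (.add (.numVar 1) (powCountT (nextPowT M)))
      (.add t (powCountT (.numVar 2))))))
    (.mul (.numVar 2) S)))

/-- The term for `approxCarry` at position `t`. -/
def approxCarryT (S M t : Term L) : Term L :=
  countT 4 (windowT S M t)
    (.le (.mul (.add (.numVar 4) .one) (nextPowT M)) (windowT S M t))

/-- The value of `S`, which has the number variable `1` as its argument, at `t`. -/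
def atT (S t : Term L) : Term L :=
  sumT 1 (.add t .one) (.mul (indT (eqF (.numVar 1) t)) S)

/-- A carry in excess of the approximate one is generated at position `t`. -/
def generateF (S M t : Term L) : Formula L :=
  .le (.add (.add (.add (approxCarryT S M (.add t .one)) (approxCarryT S M (.add t .one))) .one)
    .one) (.add (approxCarryT S M t) (atT S t))

/-- A carry in excess of the approximate one is propagated at position `t`. -/
def propagateF (S M t : Term L) : Formula L :=
  .le (.add (.add (approxCarryT S M (.add t .one)) (approxCarryT S M (.add t .one))) .one)
    (.add (approxCarryT S M t) (atT S t))

/-- The carry into position `ŷ` exceeds the approximate one. -/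
def excessF (S M : Term L) : Formula L :=
  exF 6 (.numVar 0) (.and (generateF S M (.numVar 6))
    (.not (exF 7 (.numVar 0) (.and (.le (.add (.numVar 6) .one) (.numVar 7))
      (.not (propagateF S M (.numVar 7)))))))

/-- The sum of the entry at position `ŷ` and the approximate carry into it is odd. -/
def oddF (S M : Term L) : Formula L :=
  exF 6 (.add (approxCarryT S M (.numVar 0)) (atT S (.numVar 0)))
    (eqF (.add (approxCarryT S M (.numVar 0)) (atT S (.numVar 0)))
      (.add (.add (.numVar 6) (.numVar 6)) .one))

/-- The bit at position `ŷ` of the sum of the numbers `2 ^ j * S j`: exactly one of `excessF` and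
`oddF` holds. -/
def bitF (S M : Term L) : Formula L :=
  .not (.and (.not (.and (excessF S M) (.not (oddF S M))))
    (.not (.and (.not (excessF S M)) (oddF S M))))

section

variable {A : Type} [L.Structure A] (α : Assignment A) (ρ : NumberVar → ℕ)

@[simp] theorem holds_pow2F :
    (pow2F : Formula L).Holds (α.withNumber ρ) ↔ ∃ k, ρ 2 = 2 ^ k := by
  rw [exists_eq_two_pow_iff]
  simp [pow2F]

@[simp] theorem value_powCountT (t : Term L) :
    (powCountT t).value (α.withNumber ρ) = powCount (t.value (α.withNumber ρ)) := by
  classical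
  simp [powCountT, powCount]

theorem value_nextPowT {M : Term L} {m w : ℕ} (hM : ∀ ρ, M.value (α.withNumber ρ) = m)
    (hw : ∀ k, 2 ^ k ≤ m ↔ k < w) : (nextPowT M).value (α.withNumber ρ) = 2 ^ w := by
  classical
  have := sum_pow_le_eq hw fun z => z
  simp only [nextPowT, value_add, value_one, value_sumT, hM, value_mul, value_indT, holds_pow2F,
    value_numVar, Function.update_self, ne_eq, Nat.reduceEqDiff,
    not_false_eq_true, Function.update_of_ne, ite_mul, one_mul, zero_mul]
  rw [this, Nat.geomSum_eq le_rfl]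
  have : 0 < 2 ^ w := by positivity
  omega

/-- `t` has the value `i` under all number assignments that agree with `ρ` on the variables `0` and
`6, 7, …`, so that `t` may be used within the scope of the variables `1, …, 5`. -/
def Settled (t : Term L) (i : ℕ) : Prop :=
  ∀ ρ' : NumberVar → ℕ, (∀ y : ℕ, y = 0 ∨ 6 ≤ y → ρ' y = ρ y) → t.value (α.withNumber ρ') = i

theorem Settled.value {t : Term L} {i : ℕ} (h : Settled α ρ t i) :
    t.value (α.withNumber ρ) = i := h ρ fun _ _ => rfl

theorem Settled.update {t : Term L} {i : ℕ} (h : Settled α ρ t i) (y : ℕ)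
    (hy : 1 ≤ y ∧ y ≤ 5) (n : ℕ) : Settled α (Function.update ρ y n) t i := by
  intro ρ' h'
  refine h ρ' fun (v : ℕ) hv => ?_
  rw [h' v hv, Function.update_of_ne (show v ≠ y by rintro rfl; omega)]

theorem settled_numVar (y : ℕ) (hy : y = 0 ∨ 6 ≤ y) :
    Settled α ρ (.numVar y : Term L) (ρ y) := fun _ h => h y hy

theorem Settled.succ {t : Term L} {i : ℕ} (h : Settled α ρ t i) :
    Settled α ρ (.add t .one) (i + 1) := by
  intro ρ' h'
  rw [value_add, h ρ' h', value_one]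

variable {α} {S M : Term L} {s : ℕ → ℕ} {m w : ℕ}

theorem value_windowT (hS : ∀ ρ, S.value (α.withNumber ρ) = s (ρ 1))
    (hM : ∀ ρ, M.value (α.withNumber ρ) = m) (hw : ∀ k, 2 ^ k ≤ m ↔ k < w)
    {t : Term L} {i : ℕ} (ht : Settled α ρ t i) :
    (windowT S M t).value (α.withNumber ρ) = windowSum s w i := by
  classical
  rw [windowT, value_sumT, ht.value, windowSum]
  refine Finset.sum_congr rfl fun j _ => ?_
  have key := sum_pow_le_eq hw fun z => if j + w = i + powCount z then z * s j else 0
  simp only [powCount_two_pow] at key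
  rw [← key, value_sumT, value_add, hM, value_one]
  refine Finset.sum_congr rfl fun z _ => ?_
  have ht' := (((ht.update α ρ 1 (by omega) j).update α _ 2 (by omega) z).update α _ 5
    (by omega) 0).value
  simp [hS, ht', value_nextPowT α _ hM hw, powCount_two_pow, ite_and]

theorem value_approxCarryT (hS : ∀ ρ, S.value (α.withNumber ρ) = s (ρ 1))
    (hM : ∀ ρ, M.value (α.withNumber ρ) = m) (hw : ∀ k, 2 ^ k ≤ m ↔ k < w)
    {t : Term L} {i : ℕ} (ht : Settled α ρ t i) :
    (approxCarryT S M t).value (α.withNumber ρ) = approxCarry s w i := by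
  have h2 : 0 < 2 ^ w := by positivity
  classical
  rw [approxCarryT, value_countT, value_windowT ρ hS hM hw ht, approxCarry]
  rw [← Finset.card_range (windowSum s w i / 2 ^ w)]
  congr 1
  ext q
  rw [Finset.mem_filter, holds_le, value_mul, value_nextPowT α _ hM hw,
    value_windowT _ hS hM hw (ht.update α ρ 4 (by omega) q)]
  simp only [value_add, value_numVar, Function.update_self, value_one, Finset.mem_range]
  rw [← Nat.le_div_iff_mul_le h2, Nat.succ_le_iff, and_iff_right_iff_imp]
  exact fun h => h.trans_le (Nat.div_le_self _ _)

theorem value_atT (hS : ∀ ρ, S.value (α.withNumber ρ) = s (ρ 1)) {t : Term L} {i : ℕ}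
    (ht : Settled α ρ t i) : (atT S t).value (α.withNumber ρ) = s i := by
  rw [atT, value_sumT, value_add, ht.value, value_one,
    Finset.sum_eq_single_of_mem i (Finset.self_mem_range_succ i)]
  · have ht' := ((ht.update α ρ 1 (by omega) i).update α _ 5 (by omega) 0).value
    simp [hS, ht']
  · intro j _ hj
    have ht' := ((ht.update α ρ 1 (by omega) j).update α _ 5 (by omega) 0).value
    simp [ht', hj]

theorem holds_bitF (hS : ∀ ρ, S.value (α.withNumber ρ) = s (ρ 1))
    (hM : ∀ ρ, M.value (α.withNumber ρ) = m) (hs : ∀ j, s j ≤ m) {N : ℕ}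
    (hN : ∀ j, N ≤ j → s j = 0) :
    (bitF S M).Holds (α.withNumber ρ) ↔
      (∑ j ∈ Finset.range N, 2 ^ j * s j).testBit (ρ 0) = true := by
  obtain ⟨w, hmw, hw⟩ := exists_two_pow_window m
  have hL := fun ρ {t : Term L} {i : ℕ} (ht : Settled α ρ t i) =>
    value_approxCarryT ρ hS hM hw ht
  have hA := fun ρ {t : Term L} {i : ℕ} (ht : Settled α ρ t i) => value_atT ρ hS ht
  have hodd : (oddF S M).Holds (α.withNumber ρ) ↔
      (approxCarry s w (ρ 0) + s (ρ 0)) % 2 = 1 := by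
    have h0 := fun ρ => settled_numVar (L := L) α ρ 0 (by omega)
    simp only [oddF, holds_exF, holds_eqF, value_add, hL _ (h0 _), hA _ (h0 _), value_numVar,
      Function.update_self, value_one, ne_eq, OfNat.zero_ne_ofNat, not_false_eq_true,
      Function.update_of_ne]
    constructor
    · rintro ⟨n, -, h⟩; omega
    · intro h; exact ⟨(approxCarry s w (ρ 0) + s (ρ 0)) / 2, by omega, by omega⟩
  have hexc : (excessF S M).Holds (α.withNumber ρ) ↔
      approxCarry s w (ρ 0) < (∑ j ∈ Finset.range (ρ 0), 2 ^ j * s j) / 2 ^ (ρ 0) := by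
    have h6 := fun ρ => settled_numVar (L := L) α ρ 6 (by omega)
    have h7 := fun ρ => settled_numVar (L := L) α ρ 7 (by omega)
    rw [approxCarry_lt_iff hs hmw]
    simp [excessF, generateF, propagateF, hL _ (h6 _), hA _ (h6 _), hL _ (h7 _), hA _ (h7 _),
      hL _ ((h6 _).succ), hL _ ((h7 _).succ)]
  have hC := approxCarry_spec hs hmw (ρ 0)
  -- By `hC`, the carry is the approximate one plus `1` if `excessF` holds, and plus `0` otherwise.
  rw [testBit_sum_two_pow hN]
  simp only [bitF, holds_not, holds_and, hodd, hexc]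
  omega

/-- If all entries are at most `m`, and zero from position `m` on, then `bitF` and the bound `M + M`
specify the sum of the numbers `2 ^ j * s j`. -/
theorem exprNum_bitF (hS : ∀ ρ, S.value (α.withNumber ρ) = s (ρ 1))
    (hM : ∀ ρ, M.value (α.withNumber ρ) = m) (hs : ∀ j, s j ≤ m)
    (hm : ∀ j, m ≤ j → s j = 0) :
    exprNum (bitF S M) (.add M M) α = ∑ j ∈ Finset.range m, 2 ^ j * s j := by
  have hM' : M.value α = m := hM α.number
  rw [exprNum, value_add, hM', ← bitsToNat_testBit (sum_two_pow_lt hs)]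
  congr 1
  ext i
  rw [Set.mem_ofPred_eq, setHat_eq_withNumber, holds_bitF _ hS hM hs hm, Function.update_self]
  rfl

end

/-! ### Arithmetical and plain expressions -/

theorem isArithmetical_countT {y : NumberVar} {θ : Term L} {φ : Formula L} :
    (countT y θ φ).IsArithmetical ↔ θ.IsArithmetical ∧ φ.IsArithmetical := by
  simp [countT, Expr.IsArithmetical]

theorem isArithmetical_sumT {y : NumberVar} {θ F : Term L} :
    (sumT y θ F).IsArithmetical ↔ θ.IsArithmetical ∧ F.IsArithmetical := by
  simp [sumT, Expr.IsArithmetical, Fin.forall_fin_two]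

theorem isPlain_countT {y : NumberVar} {θ : Term L} {φ : Formula L} :
    (countT y θ φ).IsPlain ↔ θ.IsPlain ∧ φ.IsPlain := by
  simp [countT, Expr.IsPlain]

theorem isPlain_sumT {y : NumberVar} {θ F : Term L} :
    (sumT y θ F).IsPlain ↔ θ.IsPlain ∧ F.IsPlain := by
  simp [sumT, Expr.IsPlain, Fin.forall_fin_two]

theorem isArithmetical_bitF {S M : Term L} (hS : S.IsArithmetical) (hM : M.IsArithmetical) :
    (bitF S M).IsArithmetical := by
  simp [bitF, excessF, oddF, generateF, propagateF, atT, approxCarryT, windowT, nextPowT,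
    powCountT, pow2F, indT, exF, eqF, isArithmetical_countT, isArithmetical_sumT,
    Expr.IsArithmetical, hS, hM]

theorem isPlain_bitF {S M : Term L} (hS : S.IsPlain) (hM : M.IsPlain) : (bitF S M).IsPlain := by
  simp [bitF, excessF, oddF, generateF, propagateF, atT, approxCarryT, windowT, nextPowT,
    powCountT, pow2F, indT, exF, eqF, isPlain_countT, isPlain_sumT, Expr.IsPlain, hS, hM]

/-! ### Sums of families of numbers -/

open scoped Classical in
/-- Sorting a sum of numbers by bit positions. -/
theorem sum_bitsToNat {ι : Type} (D : Finset ι) (B : ι → Set ℕ) (f : ι → ℕ) {m : ℕ}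
    (hm : ∀ d ∈ D, f d ≤ m) :
    ∑ d ∈ D, bitsToNat (B d) (f d)
      = ∑ j ∈ Finset.range m, 2 ^ j * (D.filter fun d => j < f d ∧ j ∈ B d).card := by
  have h : ∀ d ∈ D, bitsToNat (B d) (f d)
      = ∑ j ∈ Finset.range m, if j < f d ∧ j ∈ B d then 2 ^ j else 0 := by
    intro d hd
    rw [bitsToNat, ← Finset.sum_filter]
    congr 1
    ext j
    have := hm d hd
    simp only [Finset.mem_filter, Finset.mem_range]
    constructor
    · exact fun h => ⟨h.1.trans_le this, h⟩
    · exact fun h => h.2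
  rw [Finset.sum_congr rfl h, Finset.sum_comm]
  refine Finset.sum_congr rfl fun j _ => ?_
  rw [← Finset.sum_filter, Finset.sum_const, smul_eq_mul, mul_comm]

section uniform

/-- The term for a function variable without arguments. -/
def constT (U : FunVar []) : Term L := .funApp [] U .nil

/-- The number of `i < U` with `j < U` and `Y(j, i)`, where `j` is the number variable `1`. -/
def uniformColumnT (Y : RelVar [.n, .n]) (U : FunVar []) : Term L :=
  countT 2 (constT U) (.and (.le (.add (.numVar 1) .one) (constT U))
    (.relApp [.n, .n] Y (.consN (.numVar 1) (.consN (.numVar 2) .nil))))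

theorem exprNum_uniform {A : Type} [L.Structure A] (Y : RelVar [.n, .n]) (U : FunVar [])
    (α : Assignment A) :
    exprNum (L := L) (bitF (uniformColumnT Y U) (constT U)) (.add (constT U) (constT U)) α
      = ∑ i ∈ Finset.range (α.func [] U ()), varNumUniform Y U α i := by
  classical
  set m := α.func [] U () with hm
  have hU : ∀ ρ, (constT U : Term L).value (α.withNumber ρ) = m := fun _ => rfl
  have hB := sum_bitsToNat (Finset.range m)
    (fun i => {j | ((j, i, ()) : ℕ × ℕ × Unit) ∈ α.rel [.n, .n] Y}) (fun _ => m)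
    (fun _ _ => le_rfl)
  refine Eq.trans ?_ hB.symm
  refine exprNum_bitF (fun ρ => ?_) hU (fun j => ?_) (fun j hj => ?_)
  · rw [uniformColumnT, value_countT, hU]
    congr 1
    ext i
    simp only [Finset.mem_filter, holds_and, holds_le, hU]
    exact Iff.rfl
  · exact (Finset.card_filter_le _ _).trans_eq (Finset.card_range m)
  · rw [Finset.card_eq_zero, Finset.filter_eq_empty_iff]
    exact fun _ _ h => hj.not_gt h.1

theorem isArithmetical_uniformColumnT (Y : RelVar [.n, .n]) (U : FunVar []) :
    (uniformColumnT Y U : Term L).IsArithmetical := by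
  simp [uniformColumnT, constT, isArithmetical_countT, Expr.IsArithmetical]

end uniform

section family

/-- The argument list `(x, y)` of type `v^k n^l`. -/
def vnArgs : (k l : ℕ) → (Fin k → VertexVar) → (Fin l → NumberVar) → Expr L (.args (vn k l))
  | 0, 0, _, _ => .nil
  | 0, l + 1, x, y => .consN (.numVar (y 0)) (vnArgs 0 l x fun i => y i.succ)
  | k + 1, l, x, y => .consV (x 0) (vnArgs k l (fun i => x i.succ) y)

theorem eval_vnArgs {A : Type} [L.Structure A] (α : Assignment A) :
    ∀ (k l : ℕ) (x : Fin k → VertexVar) (y : Fin l → NumberVar),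
      (vnArgs k l x y : Expr L (.args (vn k l))).eval α
        = mkTuple k l (fun i => α.vertex (x i)) (fun i => α.number (y i))
  | 0, 0, _, _ => by
    rw [vnArgs, mkTuple]
    rfl
  | 0, l + 1, x, y => by
    have := eval_vnArgs α 0 l x fun i => y i.succ
    rw [vnArgs, mkTuple]
    exact Prod.ext rfl this
  | k + 1, l, x, y => by
    have := eval_vnArgs α k l (fun i => x i.succ) y
    rw [vnArgs, mkTuple]
    exact Prod.ext rfl this

theorem isArithmetical_vnArgs : ∀ (l : ℕ) (x : Fin 0 → VertexVar) (y : Fin l → NumberVar),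
    (vnArgs 0 l x y : Expr L (.args (vn 0 l))).IsArithmetical
  | 0, _, _ => by
    rw [vnArgs]
    trivial
  | l + 1, x, y => by
    rw [vnArgs]
    exact ⟨trivial, isArithmetical_vnArgs l x fun i => y i.succ⟩

/-- The vertex variables that range over the first components of the index tuples. -/
def tupleX (k : ℕ) : Fin k → VertexVar := fun i => i

/-- The number variables that range over the second components of the index tuples. They start at
`2`, since the number variable `1` denotes a bit position. -/
def tupleY (l : ℕ) : Fin l → NumberVar := fun i => (i + 2 : ℕ)

theorem tupleX_injective (k : ℕ) : Function.Injective (tupleX k) := Fin.val_injective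

theorem tupleY_injective (l : ℕ) : Function.Injective (tupleY l) := fun i j h => by
  have : (i : ℕ) + 2 = j + 2 := h
  exact Fin.ext (by omega)

/-- The term that sums the values of `F` over all tuples `(x, y)` with entries `y` below `V(x)` that
satisfy `φ`: an additional number variable ranges below `F`. -/
def boxSumT (k l : ℕ) (V : FunVar (vn k 0)) (F : Term L) (φ : Formula L) : Term L :=
  .count k (l + 1) (by omega) (tupleX k) (tupleX_injective k) (tupleY (l + 1))
    (tupleY_injective (l + 1))
    (Fin.snoc (α := fun _ => Term L) (fun _ => .funApp (vn k 0) V (vnArgs k 0 (tupleX k) Fin.elim0))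
      F) φ

/-- The index tuples over which `boxSumT` sums, with the bound `v`. -/
def box {A : Type} [Fintype A] (k l : ℕ) (v : (Fin k → A) → ℕ) :
    Finset ((Fin k → A) × (Fin l → ℕ)) := by
  classical exact (Finset.univ.sigma fun a : Fin k → A => Fintype.piFinset fun _ : Fin l =>
    Finset.range (v a)).map (Equiv.sigmaEquivProd _ _).toEmbedding

theorem mem_box {A : Type} [Fintype A] {k l : ℕ} {v : (Fin k → A) → ℕ}
    {d : (Fin k → A) × (Fin l → ℕ)} : d ∈ box k l v ↔ ∀ i, d.2 i < v d.1 := by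
  obtain ⟨a, b⟩ := d
  simp [box, Equiv.sigmaEquivProd]

open scoped Classical in
theorem value_boxSumT {A : Type} [Fintype A] [L.Structure A] (α : Assignment A) {k l : ℕ}
    (V : FunVar (vn k 0)) {F : Term L} {φ : Formula L}
    {f : (Fin k → A) × (Fin l → ℕ) → ℕ} {p : (Fin k → A) × (Fin l → ℕ) → Prop}
    (hF : ∀ (β : Assignment A), β.rel = α.rel → β.func = α.func → β.number 1 = α.number 1 →
      F.value β = f (fun i => β.vertex (tupleX k i), fun i => β.number (tupleY l i)))
    (hφ : ∀ (β : Assignment A), β.rel = α.rel → β.func = α.func → β.number 1 = α.number 1 →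
      (φ.Holds β ↔ p (fun i => β.vertex (tupleX k i), fun i => β.number (tupleY l i)))) :
    (boxSumT k l V F φ).value α = ∑ d ∈ (box k l fun a =>
      α.func (vn k 0) V (mkTuple k 0 a Fin.elim0)).filter p, f d := by
  rw [← ncard_setOf_last_lt]
  change Set.ncard {c : (Fin k → A) × (Fin (l + 1) → ℕ) | _ ∧ _} = _
  congr 1
  ext ⟨a, c⟩
  have h1 : ∀ {n : ℕ} (y : Fin n → NumberVar), ¬ ∃ i, tupleY n i = 1 := by
    rintro n - ⟨i, h⟩
    have : (i : ℕ) + 2 = 1 := h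
    omega
  have hx : ∀ {κ : Type} (y : κ → NumberVar) (b : κ → ℕ),
      (fun i => (α.subst (tupleX k) a y b).vertex (tupleX k i)) = a := by
    intro κ y b
    funext i
    exact (tupleX_injective k).extend_apply _ _ _
  have hV : ∀ i : Fin l, Expr.eval (Fin.snoc (α := fun _ => Term L)
      (fun _ => .funApp (vn k 0) V (vnArgs k 0 (tupleX k) Fin.elim0)) F i.castSucc)
      (α.subst (tupleX k) a (fun j : {j : Fin (l + 1) // j < i.castSucc} => tupleY (l + 1) j)
        (fun j => c j)) = α.func (vn k 0) V (mkTuple k 0 a Fin.elim0) := by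
    intro i
    rw [Fin.snoc_castSucc]
    change α.func (vn k 0) V (Expr.eval (κ := .args (vn k 0)) _ _) = _
    rw [eval_vnArgs, hx]
    congr 2
    exact Subsingleton.elim _ _
  have hF' : Expr.eval (Fin.snoc (α := fun _ => Term L)
      (fun _ => .funApp (vn k 0) V (vnArgs k 0 (tupleX k) Fin.elim0)) F (Fin.last l))
      (α.subst (tupleX k) a (fun j : {j : Fin (l + 1) // j < Fin.last l} => tupleY (l + 1) j)
        (fun j => c j)) = f (a, Fin.init c) := by
    rw [Fin.snoc_last]
    refine (hF (α.subst _ _ _ _) rfl rfl ?_).trans ?_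
    · exact Function.extend_apply' (f := fun j : {j : Fin (l + 1) // j < Fin.last l} =>
        tupleY (l + 1) j) (fun j => c j) α.number 1 fun ⟨i, hi⟩ => h1 (tupleY (l + 1)) ⟨_, hi⟩
    · rw [hx]
      congr 2
      funext i
      exact ((tupleY_injective (l + 1)).comp Subtype.val_injective).extend_apply (fun j => c j)
        α.number (⟨i.castSucc, Fin.castSucc_lt_last i⟩ : {j : Fin (l + 1) // j < Fin.last l})
  have hφ' : Expr.eval φ (α.subst (tupleX k) a (tupleY (l + 1)) c) ↔ p (a, Fin.init c) := by
    refine (hφ (α.subst _ _ _ _) rfl rfl ?_).trans ?_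
    · exact Function.extend_apply' _ _ _ (h1 (tupleY (l + 1)))
    · rw [hx]
      have : (fun i : Fin l => (α.subst (tupleX k) a (tupleY (l + 1)) c).number (tupleY l i))
          = Fin.init c := by
        funext i
        exact (tupleY_injective (l + 1)).extend_apply _ _ i.castSucc
      rw [this]
  simp only [Set.mem_ofPred_eq, Fin.forall_fin_succ', hV, hF', hφ', Finset.mem_filter, mem_box]
  exact ⟨fun h => ⟨⟨h.1.1, h.2⟩, h.1.2⟩, fun h => ⟨⟨h.1.1, h.2⟩, h.1.2⟩⟩

variable {k l : ℕ} (X : RelVar (vn k l)) (Y : RelVar (.n :: vn k l)) (U : FunVar (vn k l))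
  (V : FunVar (vn k 0))

/-- The bit length `U(x, y)` of the number with index `(x, y)`. -/
def lengthT : Term L := .funApp (vn k l) U (vnArgs k l (tupleX k) (tupleY l))

/-- The sum of all bit lengths. It bounds the bit lengths, and also the number of indices whose bit
length is positive. -/
def totalT : Term L := boxSumT k l V (lengthT U) (.le .zero .zero)

/-- The number of indices in `X` whose number has a `1` at the bit position denoted by the number
variable `1`. Every counted index contributes the value `1`, so that the case `k = l = 0` needs no
separate treatment. -/
def columnT : Term L := boxSumT k l V .one (.and (.le (.add (.numVar 1) .one) (lengthT U))
  (.and (.relApp (vn k l) X (vnArgs k l (tupleX k) (tupleY l)))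
    (.relApp (.n :: vn k l) Y (.consN (.numVar 1) (vnArgs k l (tupleX k) (tupleY l))))))

theorem exprNum_family {A : Type} [Fintype A] [L.Structure A] (α : Assignment A) :
    exprNum (L := L) (bitF (columnT X Y U V) (totalT U V)) (.add (totalT U V) (totalT U V)) α
      = ∑ a : Fin k → A, ∑ b ∈ Fintype.piFinset (fun _ : Fin l =>
          Finset.range (α.func (vn k 0) V (mkTuple k 0 a Fin.elim0))),
          open scoped Classical in
          if mkTuple k l a b ∈ α.rel (vn k l) X then varNum (vn k l) Y U α (mkTuple k l a b)
          else 0 := by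
  classical
  set D : Finset ((Fin k → A) × (Fin l → ℕ)) := box k l fun a =>
    α.func (vn k 0) V (mkTuple k 0 a Fin.elim0) with hD
  have hsum : ∀ g : (Fin k → A) × (Fin l → ℕ) → ℕ, ∑ d ∈ D, g d
      = ∑ a : Fin k → A, ∑ b ∈ Fintype.piFinset (fun _ : Fin l =>
          Finset.range (α.func (vn k 0) V (mkTuple k 0 a Fin.elim0))), g (a, b) := by
    intro g
    rw [hD, box, Finset.sum_map, Finset.sum_sigma]
    rfl
  let u : (Fin k → A) × (Fin l → ℕ) → ℕ := fun d => α.func (vn k l) U (mkTuple k l d.1 d.2)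
  have hu : ∀ d ∈ D, u d ≤ ∑ d ∈ D, u d := fun d hd =>
    Finset.single_le_sum (f := u) (fun _ _ => Nat.zero_le _) hd
  have hB := sum_bitsToNat (D.filter fun d => mkTuple k l d.1 d.2 ∈ α.rel (vn k l) X)
    (fun d => {j | ((j, mkTuple k l d.1 d.2) : ℕ × Tuple A (vn k l)) ∈ α.rel (.n :: vn k l) Y})
    u (fun d hd => hu d (Finset.mem_filter.1 hd).1)
  rw [← hsum fun d => if mkTuple k l d.1 d.2 ∈ α.rel (vn k l) X then
    varNum (vn k l) Y U α (mkTuple k l d.1 d.2) else 0, ← Finset.sum_filter]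
  refine Eq.trans ?_ hB.symm
  have hlen : ∀ β : Assignment A, β.func = α.func → (lengthT U : Term L).value β
      = u (fun i => β.vertex (tupleX k i), fun i => β.number (tupleY l i)) := by
    intro β hβ
    change β.func (vn k l) U (Expr.eval (κ := .args (vn k l)) _ _) = _
    rw [eval_vnArgs, hβ]
  refine exprNum_bitF (fun ρ => ?_) (fun ρ => ?_) (fun j => ?_) (fun j hj => ?_)
  · rw [columnT, value_boxSumT (f := fun _ => 1)
      (p := fun d => ρ 1 < u d ∧ mkTuple k l d.1 d.2 ∈ α.rel (vn k l) X ∧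
        ((ρ 1, mkTuple k l d.1 d.2) : ℕ × Tuple A (vn k l)) ∈ α.rel (.n :: vn k l) Y)]
    · rw [← Finset.card_eq_sum_ones, Finset.filter_filter]
      congr 1
      ext d
      simp only [Finset.mem_filter]
      exact and_congr_right fun _ => and_left_comm
    · intros; rfl
    · intro β hr hf hn
      rw [holds_and, holds_and, holds_le, hlen β hf]
      refine and_congr ?_ (and_congr ?_ ?_)
      · change β.number 1 + 1 ≤ _ ↔ _
        rw [hn]; rfl
      · change Expr.eval (κ := .args (vn k l)) _ _ ∈ β.rel (vn k l) X ↔ _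
        rw [eval_vnArgs, hr]; rfl
      · change ((β.number 1, Expr.eval (κ := .args (vn k l)) _ _) : ℕ × Tuple A (vn k l))
          ∈ β.rel (.n :: vn k l) Y ↔ _
        rw [eval_vnArgs, hr, hn]; rfl
  · have := value_boxSumT (α.withNumber ρ) V (F := lengthT U) (φ := .le .zero .zero) (f := u)
      (p := fun _ => True) (fun β _ hf _ => hlen β hf) (fun β _ _ _ => by simp)
    rw [Finset.filter_true] at this
    exact this
  · rw [Finset.filter_filter, Finset.card_eq_sum_ones, Finset.sum_filter]
    refine Finset.sum_le_sum fun d _ => ?_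
    split_ifs with h
    · have := h.2.1; omega
    · exact Nat.zero_le _
  · rw [Finset.card_eq_zero, Finset.filter_eq_empty_iff]
    intro d hd h
    exact absurd (h.1.trans_le (hu d (Finset.mem_filter.1 hd).1)) hj.not_gt

theorem isArithmetical_boxSumT {l : ℕ} {V : FunVar (vn 0 0)} {F : Term L} {φ : Formula L}
    (hF : F.IsArithmetical) (hφ : φ.IsArithmetical) : (boxSumT 0 l V F φ).IsArithmetical := by
  refine ⟨rfl, fun i => ?_, hφ⟩
  refine Fin.lastCases ?_ (fun i => ?_) i
  · rwa [Fin.snoc_last]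
  · rw [Fin.snoc_castSucc]
    exact isArithmetical_vnArgs 0 _ _

theorem isArithmetical_totalT {l : ℕ} (U : FunVar (vn 0 l)) (V : FunVar (vn 0 0)) :
    (totalT U V : Term L).IsArithmetical :=
  isArithmetical_boxSumT (isArithmetical_vnArgs l _ _) ⟨trivial, trivial⟩

theorem isArithmetical_columnT {l : ℕ} (X : RelVar (vn 0 l)) (Y : RelVar (.n :: vn 0 l))
    (U : FunVar (vn 0 l)) (V : FunVar (vn 0 0)) : (columnT X Y U V : Term L).IsArithmetical := by
  have h := isArithmetical_vnArgs (L := L) l (tupleX 0) (tupleY l)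
  exact isArithmetical_boxSumT trivial ⟨⟨⟨trivial, trivial⟩, h⟩, h, trivial, h⟩

end family

/-! ### Ordered structures -/

section ordered

/-- The counting term `#(x₁, …, xₖ). φ` without number variables. -/
def vertexCountT {k : ℕ} (hk : 1 ≤ k) (x : Fin k → VertexVar) (hx : Function.Injective x)
    (φ : Formula bitOrder) : Term bitOrder :=
  .count k 0 hk x hx Fin.elim0 (fun i => i.elim0) Fin.elim0 φ

theorem value_vertexCountT {A : Type} [bitOrder.Structure A] (α : Assignment A) {k : ℕ}
    (hk : 1 ≤ k) (x : Fin k → VertexVar) (hx : Function.Injective x) (φ : Formula bitOrder) :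
    (vertexCountT hk x hx φ).value α
      = Set.ncard {a | φ.Holds { α with vertex := Function.extend x a α.vertex }} := by
  rw [← Set.ncard_image_of_injective _
    (f := fun a : Fin k → A => ((a, Fin.elim0) : (Fin k → A) × (Fin 0 → ℕ)))
    (fun a b h => congrArg Prod.fst h)]
  change Set.ncard {c : (Fin k → A) × (Fin 0 → ℕ) | _ ∧ _} = _
  congr 1
  ext ⟨a, b⟩
  obtain rfl : b = Fin.elim0 := Subsingleton.elim _ _
  have : α.subst x a (Fin.elim0 : Fin 0 → NumberVar) Fin.elim0
      = { α with vertex := Function.extend x a α.vertex } := by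
    have h := extend_of_isEmpty (Fin.elim0 : Fin 0 → NumberVar) Fin.elim0 α.number
    unfold Assignment.subst
    rw [h]
  simp [this, Formula.Holds]

/-- The order of the structure. -/
def cardT : Term bitOrder :=
  vertexCountT (k := 1) le_rfl (fun _ => 4) (Function.injective_of_subsingleton _) (.le .zero .zero)

/-- The position of the vertex variable `v`, which must not be `4`. -/
def posT (v : VertexVar) : Term bitOrder :=
  vertexCountT (k := 1) le_rfl (fun _ => 4) (Function.injective_of_subsingleton _)
    (.and (.rel (k := 2) BitOrderRel.le ![4, v]) (.not (.vertexEq 4 v)))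

/-- The number of pairs `(x₂, x₃)` such that the number with index `x₂` has a `1` at the bit position
of `x₃`, and this position is the value of the number variable `1`. As vertex variables, `tupleY 2`
are the variables `2` and `3`. -/
def orderedColumnT : Term bitOrder :=
  vertexCountT (k := 2) (by norm_num) (tupleY 2) (tupleY_injective 2)
    (.and (.rel (k := 2) BitOrderRel.bit ![3, 2]) (eqF (posT 3) (.numVar 1)))

/-- The formula for the bits of the sum of the numbers encoded by an ordered structure. -/
def orderedBitF : Formula bitOrder :=
  exF 0 (.add (.add (posT 0) (.mul cardT (posT 1))) .one)
    (.and (eqF (.numVar 0) (.add (posT 0) (.mul cardT (posT 1))))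
      (bitF orderedColumnT (.mul cardT cardT)))

theorem isPlain_orderedBitF : orderedBitF.IsPlain := by
  have h := isPlain_bitF (S := orderedColumnT) (M := .mul cardT cardT)
    (by simp [orderedColumnT, vertexCountT, posT, eqF, Expr.IsPlain])
    (by simp [cardT, vertexCountT, Expr.IsPlain])
  have h0 : ∀ v, (posT v).IsPlain := fun v => by simp [posT, vertexCountT, Expr.IsPlain]
  have h1 : cardT.IsPlain := by simp [cardT, vertexCountT, Expr.IsPlain]
  simp [orderedBitF, exF, isPlain_countT, Expr.IsPlain, h, h0, h1, eqF]

theorem value_cardT {A : Type} [Fintype A] [bitOrder.Structure A] (α : Assignment A) :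
    cardT.value α = Fintype.card A := by
  rw [cardT, value_vertexCountT]
  simp [Set.ncard_univ, Nat.card_eq_fintype_card]

theorem pos_lt_card {A : Type} [Fintype A] [LinearOrder A] (a : A) : pos a < Fintype.card A := by
  rw [pos, ← Nat.card_eq_fintype_card]
  exact Set.ncard_lt_card (fun h => lt_irrefl a (h ▸ Set.mem_univ a : a ∈ {b | b < a}))

theorem value_posT {A : Type} [LinearOrder A] [bitOrder.Structure A] (α : Assignment A)
    (hle : ∀ b a : A, Le b a ↔ b ≤ a) (v : ℕ) (hv : v ≠ 4) :
    (posT v).value α = pos (α.vertex v) := by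
  rw [posT, value_vertexCountT, pos, ← Set.ncard_image_of_injective _
    (f := fun b : A => fun _ : Fin 1 => b) (fun a b h => congrFun h 0)]
  congr 1
  ext b
  obtain ⟨b, rfl⟩ : ∃ c, b = fun _ => c := ⟨b 0, by funext i; rw [Subsingleton.elim i 0]⟩
  have h4 : Function.extend (fun _ : Fin 1 => (4 : VertexVar)) (fun _ => b) α.vertex 4 = b :=
    (Function.injective_of_subsingleton _).extend_apply _ _ (0 : Fin 1)
  have hv' : Function.extend (fun _ : Fin 1 => (4 : VertexVar)) (fun _ => b) α.vertex v
      = α.vertex v := Function.extend_apply' _ _ _ fun ⟨_, h⟩ => hv h.symm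
  have hrel : ∀ β : Assignment A,
      (Formula.Holds (.rel (L := bitOrder) (k := 2) BitOrderRel.le ![4, v]) β
        ↔ Le (β.vertex 4) (β.vertex v)) := by
    intro β
    change FirstOrder.Language.Structure.RelMap _ _ ↔ FirstOrder.Language.Structure.RelMap _ _
    congr! 1
    funext i
    fin_cases i <;> rfl
  rw [Set.mem_ofPred_eq, holds_and, holds_not, hrel, hle, holds_vertexEq]
  simp only [h4, hv', ← lt_iff_le_and_ne, Set.mem_image, Set.mem_ofPred_eq]
  exact ⟨fun h => ⟨b, h, rfl⟩, fun ⟨c, hc, h⟩ => congrFun h 0 ▸ hc⟩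

variable {A : Type} [Fintype A] [LinearOrder A] [bitOrder.Structure A] (α : Assignment A)

open scoped Classical in
theorem value_orderedColumnT (hle : ∀ b a : A, Le b a ↔ b ≤ a) :
    orderedColumnT.value α
      = (Finset.univ.filter fun p : A × A => Bit p.2 p.1 ∧ pos p.2 = α.number 1).card := by
  rw [orderedColumnT, value_vertexCountT, ← Set.ncard_coe_finset, ← Set.ncard_image_of_injective _
    (finTwoArrowEquiv A).symm.injective]
  congr 1
  ext c
  obtain ⟨⟨a, b⟩, rfl⟩ := (finTwoArrowEquiv A).symm.surjective c
  rw [Function.Injective.mem_set_image (finTwoArrowEquiv A).symm.injective, Set.mem_ofPred_eq]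
  have h2 : Function.extend (tupleY 2) ((finTwoArrowEquiv A).symm (a, b)) α.vertex 2 = a :=
    (tupleY_injective 2).extend_apply _ _ 0
  have h3 : Function.extend (tupleY 2) ((finTwoArrowEquiv A).symm (a, b)) α.vertex 3 = b :=
    (tupleY_injective 2).extend_apply _ _ 1
  have hrel : ∀ β : Assignment A,
      (Formula.Holds (.rel (L := bitOrder) (k := 2) BitOrderRel.bit ![3, 2]) β
        ↔ Bit (β.vertex 3) (β.vertex 2)) := by
    intro β
    change FirstOrder.Language.Structure.RelMap _ _ ↔ FirstOrder.Language.Structure.RelMap _ _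
    congr! 1
    funext i
    fin_cases i <;> rfl
  rw [holds_and, hrel, holds_eqF, value_posT _ hle 3 (by norm_num)]
  change Bit (Function.extend _ _ _ _) (Function.extend _ _ _ _) ∧
    pos (Function.extend _ _ _ _) = α.number 1 ↔ _
  rw [h2, h3]
  simp

open scoped Classical in
theorem structSum_eq : structSum A = ∑ j ∈ Finset.range (Fintype.card A),
    2 ^ j * (Finset.univ.filter fun p : A × A => Bit p.2 p.1 ∧ pos p.2 = j).card := by
  have h : ∀ j, 2 ^ j * (Finset.univ.filter fun p : A × A => Bit p.2 p.1 ∧ pos p.2 = j).card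
      = ∑ p ∈ (Finset.univ.filter fun p : A × A => Bit p.2 p.1) with pos p.2 = j,
          2 ^ pos p.2 := by
    intro j
    rw [Finset.filter_filter, Finset.sum_congr rfl fun p hp => by
      rw [(Finset.mem_filter.1 hp).2.2], Finset.sum_const, smul_eq_mul, mul_comm]
  simp only [h]
  rw [Finset.sum_fiberwise_of_maps_to fun p _ => Finset.mem_range.2 (pos_lt_card p.2),
    Finset.sum_filter, Fintype.sum_prod_type, structSum]
  exact Finset.sum_congr rfl fun a _ => Finset.sum_filter _ _

theorem holds_orderedBitF (hle : ∀ b a : A, Le b a ↔ b ≤ a) :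
    orderedBitF.Holds α ↔ (structSum A).testBit
      (pos (α.vertex 0) + Fintype.card A * pos (α.vertex 1)) = true := by
  classical
  have h0 : ∀ ρ, (posT 0).value (α.withNumber ρ) = pos (α.vertex 0) :=
    fun ρ => value_posT _ hle 0 (by norm_num)
  have h1 : ∀ ρ, (posT 1).value (α.withNumber ρ) = pos (α.vertex 1) :=
    fun ρ => value_posT _ hle 1 (by norm_num)
  have hbit := fun ρ => holds_bitF (α := α) (S := orderedColumnT) (M := .mul cardT cardT)
    (m := Fintype.card A * Fintype.card A) (N := Fintype.card A)
    (s := fun j => (Finset.univ.filter fun p : A × A => Bit p.2 p.1 ∧ pos p.2 = j).card) ρ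
    (fun ρ => value_orderedColumnT _ hle)
    (fun ρ => by rw [value_mul, value_cardT])
    (fun j => (Finset.card_le_univ _).trans_eq (Fintype.card_prod A A))
    (fun j hj => by
      rw [Finset.card_eq_zero, Finset.filter_eq_empty_iff]
      rintro p - ⟨-, rfl⟩
      exact (pos_lt_card p.2).not_ge hj)
  have h := holds_exF (L := bitOrder) α α.number 0
    (.add (.add (posT 0) (.mul cardT (posT 1))) .one)
    (.and (eqF (.numVar 0) (.add (posT 0) (.mul cardT (posT 1))))
      (bitF orderedColumnT (.mul cardT cardT)))
  refine h.trans ?_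
  simp only [holds_and, holds_eqF, value_add, value_mul, value_numVar, value_one, value_cardT, h0,
    h1, hbit, Function.update_self, ← structSum_eq]
  constructor
  · rintro ⟨_, -, rfl, h⟩
    exact h
  · exact fun h => ⟨_, Nat.lt_succ_self _, rfl, h⟩

end ordered

end FOC

theorem mainTheorem7 :
    -- iterated addition of `U` numbers of `U` bits each
    (∀ (L : FirstOrder.Language.{0, 0}) [L.IsRelational]
      (Y : FOC.RelVar [.n, .n]) (U : FOC.FunVar []),
      ∃ (sItadd : FOC.Formula L) (bdSItadd : FOC.Term L),
        sItadd.IsArithmetical ∧ bdSItadd.IsArithmetical ∧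
        ∀ (A : Type) [Finite A] [L.Structure A] (α : FOC.Assignment A),
          FOC.exprNum sItadd bdSItadd α =
            ∑ i ∈ Finset.range (α.func [] U ()), FOC.varNumUniform Y U α i) ∧
    -- iterated addition of a family indexed by tuples of vertices and numbers
    (∀ (L : FirstOrder.Language.{0, 0}) [L.IsRelational] (k l : ℕ)
      (X : FOC.RelVar (FOC.vn k l)) (Y : FOC.RelVar (.n :: FOC.vn k l))
      (U : FOC.FunVar (FOC.vn k l)) (V : FOC.FunVar (FOC.vn k 0)),
      ∃ (itadd : FOC.Formula L) (bdItadd : FOC.Term L),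
        (∀ (A : Type) [Fintype A] [L.Structure A] (α : FOC.Assignment A),
          FOC.exprNum itadd bdItadd α =
            ∑ a : Fin k → A,
              ∑ b ∈ Fintype.piFinset (fun _ : Fin l =>
                Finset.range (α.func (FOC.vn k 0) V (FOC.mkTuple k 0 a Fin.elim0))),
                open scoped Classical in
                if FOC.mkTuple k l a b ∈ α.rel (FOC.vn k l) X then
                  FOC.varNum (FOC.vn k l) Y U α (FOC.mkTuple k l a b)
                else 0) ∧
        (k = 0 → itadd.IsArithmetical ∧ bdItadd.IsArithmetical)) ∧
    -- over ordered structures, the bits of the iterated sum are definable in plain FO+C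
    (∃ φ : FOC.Formula FOC.bitOrder, φ.IsPlain ∧
      ∀ (A : Type) [Fintype A] [LinearOrder A] [FOC.bitOrder.Structure A],
        (∀ b a : A, FOC.Le b a ↔ b ≤ a) →
        ∀ α : FOC.Assignment A,
          φ.Holds α ↔
            (FOC.structSum A).testBit
              (FOC.pos (α.vertex 0) + Fintype.card A * FOC.pos (α.vertex 1)) = true) := by

  refine ⟨fun L _ Y U => ⟨FOC.bitF (FOC.uniformColumnT Y U) (FOC.constT U),
      .add (FOC.constT U) (FOC.constT U),
      FOC.isArithmetical_bitF (FOC.isArithmetical_uniformColumnT Y U) trivial, ⟨trivial, trivial⟩,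
      fun A _ _ α => FOC.exprNum_uniform Y U α⟩,
    fun L _ k l X Y U V => ⟨FOC.bitF (FOC.columnT X Y U V) (FOC.totalT U V),
      .add (FOC.totalT U V) (FOC.totalT U V), fun A _ _ α => FOC.exprNum_family X Y U V α, ?_⟩,
    ⟨FOC.orderedBitF, FOC.isPlain_orderedBitF, fun A _ _ _ hle α => FOC.holds_orderedBitF α hle⟩⟩
  rintro rfl
  exact ⟨FOC.isArithmetical_bitF (FOC.isArithmetical_columnT X Y U V)
    (FOC.isArithmetical_totalT U V), FOC.isArithmetical_totalT U V, FOC.isArithmetical_totalT U V⟩
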